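/- Fix integers $p\ge 3$, $k\ge 1$, $n\ge 0$ and reals $0<\lambda\le\omega$. For a simple graph $G=(V,E)$ on $V=\{1,\dots,p\}$ and edge weights $\theta=(\theta_{st})$ vanishing off $E$, let $\mathbb{P}_{\theta(G)}$ be the Ising model on $\{-1,+1\}^p$ with probability mass function $$\mathbb{P}_{\theta(G)}(x)=\frac{1}{Z(\theta)}\exp\Big\{\sum_{(s,t)\in E}\theta_{st}x_sx_t\Big\},\qquad Z(\theta)=\sum_{x\in\{-1,+1\}^p}\exp\Big\{\sum_{(s,t)\in E}\theta_{st}x_sx_t\Big\}.$$ Let $\mathcal{G}_{p,k}(\lambda,\omega)$ be the set of all such models for which $|E|\le k$, $|\theta_{st}|\ge\lambda$ for every $(s,t)\in E$, and $\sum_{t:(s,t)\in E}|\theta_{st}|\le\omega$ for every $s\in V$. A graph decoder is a function $\phi$ that maps $n$ samples $\mathbf{X}=(X^{(1)},\dots,X^{(n)})\in(\{-1,+1\}^p)^n$, drawn i.i.d. from the unknown model $\mathbb{P}_{\theta(G)}$, to a graph on $V$. In the unknown-weight setting $\phi$ sees only the data; in the known-weight setting $\phi$ is also given, for every candidate graph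 $G$, the weight vector $\theta(G)$ that is in force if $G$ is the true graph, and the worst case is taken over all such assignments $G\mapsto\theta(G)$ with $\mathbb{P}_{\theta(G)}\in\mathcal{G}_{p,k}(\lambda,\omega)$ (for those $G$ that underlie some member of the class) and over all these graphs $G$. Claim (growing number of edges, in the regime $\lambda=\mathcal{O}(k^{-1/2})$). For every $C>0$ there is a constant $c>0$, depending only on $C$, such that for all $p\ge 3$, $k\ge 1$, $n\ge 0$ and $0<\lambda\le\omega$ with $\lambda\le C\,k^{-1/2}$: if a graph decoder based on $n$ samples, with known or with unknown edge weights, satisfies $\mathbb{P}_{\theta(G)}[\phi(\mathbf{X})=G]\ge 1/2$ in the worst case over $\mathcal{G}_{p,k}(\lambda,\omega)$, then $$n>c\,\max\{k,\lambda^{-2}\}\,\log p.$$ -/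

import Mathlib

namespace IsingSelection

noncomputable section

/-- Spin configurations in `{-1,+1}^p`; `ℤˣ` is the two-element set `{1, -1}`. -/
abbrev Config (p : ℕ) : Type := Fin p → ℤˣ

/-- Edge weights, indexed by unordered pairs of vertices. -/
abbrev Weights (p : ℕ) : Type := Sym2 (Fin p) → ℝ

/-- The product `x_s x_t` for the unordered pair `e = {s,t}`, as a real number. -/
def pairSpin {p : ℕ} (x : Config p) (e : Sym2 (Fin p)) : ℝ :=
  Sym2.lift ⟨fun s t => ((x s : ℤ) : ℝ) * ((x t : ℤ) : ℝ), fun _ _ => mul_comm _ _⟩ e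

open Classical in
/-- The exponent `∑_{(s,t) ∈ E} θ_{st} x_s x_t`. -/
def energy {p : ℕ} (G : SimpleGraph (Fin p)) (θ : Weights p) (x : Config p) : ℝ :=
  ∑ e ∈ G.edgeFinset, θ e * pairSpin x e

/-- The normalization factor of the Ising model. -/
def partitionFn {p : ℕ} (G : SimpleGraph (Fin p)) (θ : Weights p) : ℝ :=
  ∑ x : Config p, Real.exp (energy G θ x)

/-- The probability mass function of the Ising model on `G` with edge weights `θ`. -/
def isingProb {p : ℕ} (G : SimpleGraph (Fin p)) (θ : Weights p) (x : Config p) : ℝ :=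
  Real.exp (energy G θ x) / partitionFn G θ

/-- The data: `n` samples. -/
abbrev Sample (n p : ℕ) : Type := Fin n → Config p

/-- A graph decoder: a function from the data to graphs on `p` vertices. -/
abbrev Decoder (n p : ℕ) : Type := Sample n p → SimpleGraph (Fin p)

/-- The probability of a data set of `n` i.i.d. samples from the Ising model. -/
def sampleProb {n p : ℕ} (G : SimpleGraph (Fin p)) (θ : Weights p) (X : Sample n p) : ℝ :=
  ∏ i, isingProb G θ (X i)

open Classical in
/-- The probability that the decoder `φ` outputs the true graph `G` from `n` i.i.d. samples
of the Ising model on `G` with weights `θ`. -/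
def successProb {n p : ℕ} (φ : Decoder n p) (G : SimpleGraph (Fin p)) (θ : Weights p) : ℝ :=
  ∑ X : Sample n p with φ X = G, sampleProb G θ X

open Classical in
/-- `(G, θ)` is a member of the class of Ising models on `p` vertices with at most `k` edges,
minimum edge weight at least `lam`, and maximum neighborhood weight at most `om`.
(The minimum over the edges of the empty graph is `+∞`.) -/
structure InFamily (p k : ℕ) (lam om : ℝ) (G : SimpleGraph (Fin p)) (θ : Weights p) : Prop where
  card_edges_le : G.edgeFinset.card ≤ k
  support : ∀ e, θ e ≠ 0 → e ∈ G.edgeSet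
  min_weight : ∀ e ∈ G.edgeSet, lam ≤ |θ e|
  max_neighborhood : ∀ s, ∑ t ∈ G.neighborFinset s, |θ s(s, t)| ≤ om

/-- The information available in the known-weight variant: to each candidate graph `G` it
assigns the weight vector `W G` that is in force when `G` is the true graph. Every graph that
underlies some member of the class is given weights that make it a member. -/
def IsWeightTable (p k : ℕ) (lam om : ℝ) (W : SimpleGraph (Fin p) → Weights p) : Prop :=
  ∀ G, (∃ θ, InFamily p k lam om G θ) → InFamily p k lam om G (W G)

end

end IsingSelection

namespace IsingSelection

open Finset

/-! Since `lam ^ 2 * k ≤ C ^ 2`, the maximum of `k` and `lam⁻²` is at most `(1 + C²) lam⁻²`, so it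
suffices to bound `n` below by a multiple of `lam⁻² log p`. Graphs with one edge of weight `lam`
already force this. There are `p.choose 2 ≥ p` of them, and each induces a law on samples whose
second moment relative to the uniform law is at most `exp (2 n lam²)`. Decoding regions are
disjoint, so by Cauchy–Schwarz laws this close to uniform cannot all give their own region mass
`1/2` (`sq_half_card_sub_one_le`); hence `exp (2 n lam²)` must exceed a fixed power of `p`. Known
weights do not help: one table may assign the constant weight `lam` to all these graphs. -/

/-- Guessing bound by the `χ²`-divergence to the uniform distribution: if each of the
distributions `P i` on `S` has mass at least `1/2` on the fibre of `d` over `g i`, then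
the number of hypotheses is controlled by the divergences. -/
theorem sq_half_card_sub_one_le {ι S T : Type*} [Fintype ι] [Fintype S] [Nonempty S]
    [DecidableEq T] (P : ι → S → ℝ) (d : S → T) (g : ι → T) (hg : Function.Injective g)
    (b : ℝ) (hsum : ∀ i, ∑ x, P i x = 1) (hsq : ∀ i, Fintype.card S * ∑ x, P i x ^ 2 ≤ b)
    (hhalf : ∀ i, 1 / 2 ≤ ∑ x with d x = g i, P i x) (hcard : 2 ≤ Fintype.card ι) :
    ((Fintype.card ι : ℝ) / 2 - 1) ^ 2 ≤ Fintype.card ι * (b - 1) := by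
  classical
  have hN : (0 : ℝ) < Fintype.card S := by exact_mod_cast Fintype.card_pos
  set N : ℝ := (Fintype.card S : ℝ) with hNdef
  set A : Finset (ι × S) := univ.filter fun q => d q.2 = g q.1 with hA
  have hAcard : (A.card : ℝ) ≤ N := by
    rw [hNdef]
    norm_cast
    rw [← card_univ]
    -- A sample decodes to at most one hypothesis, since `g` is injective. So the regions together
    -- have uniform mass at most `1`.
    refine card_le_card_of_injOn Prod.snd (by simp) ?_
    rintro ⟨i, x⟩ hi ⟨j, y⟩ hj hxy
    simp only [hA, coe_filter, mem_univ, true_and, Set.mem_ofPred_eq] at hi hj hxy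
    subst hxy
    rw [hg (hi.symm.trans hj)]
  have hlow : (Fintype.card ι : ℝ) / 2 - 1 ≤ ∑ q ∈ A, (P q.1 q.2 - N⁻¹) := by
    rw [sum_sub_distrib, sum_const, nsmul_eq_mul]
    have h1 : (A.card : ℝ) * N⁻¹ ≤ 1 := by
      rw [← div_eq_mul_inv]
      exact div_le_one_of_le₀ hAcard hN.le
    have h2 : (Fintype.card ι : ℝ) / 2 ≤ ∑ q ∈ A, P q.1 q.2 := by
      have h3 : ∑ q ∈ A, P q.1 q.2 = ∑ i, ∑ x with d x = g i, P i x := by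
        rw [hA, sum_filter, Fintype.sum_prod_type]
        simp only [sum_filter]
      rw [h3]
      calc (Fintype.card ι : ℝ) / 2 = ∑ _i : ι, (1 / 2 : ℝ) := by
            rw [sum_const, nsmul_eq_mul, card_univ]; ring
        _ ≤ _ := sum_le_sum fun i _ => hhalf i
    linarith
  have hdev : ∀ i, ∑ x, (P i x - N⁻¹) ^ 2 ≤ N⁻¹ * (b - 1) := by
    intro i
    have h : ∑ x, (P i x - N⁻¹) ^ 2 = ∑ x, P i x ^ 2 - N⁻¹ := by
      have : ∀ x, (P i x - N⁻¹) ^ 2 = P i x ^ 2 - 2 * N⁻¹ * P i x + N⁻¹ ^ 2 := fun x => by ring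
      simp only [this, sum_add_distrib, sum_sub_distrib, ← mul_sum, hsum, sum_const, nsmul_eq_mul,
        card_univ, ← hNdef]
      field_simp
      ring
    rw [h, mul_sub, mul_one]
    have := mul_le_mul_of_nonneg_left (hsq i) (inv_nonneg.2 hN.le)
    rw [← mul_assoc, inv_mul_cancel₀ hN.ne', one_mul] at this
    linarith
  have htotal : ∑ q ∈ A, (P q.1 q.2 - N⁻¹) ^ 2 ≤ Fintype.card ι * (N⁻¹ * (b - 1)) := by
    calc ∑ q ∈ A, (P q.1 q.2 - N⁻¹) ^ 2 ≤ ∑ q : ι × S, (P q.1 q.2 - N⁻¹) ^ 2 :=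
          sum_le_sum_of_subset_of_nonneg (subset_univ _) fun _ _ _ => sq_nonneg _
      _ = ∑ i, ∑ x, (P i x - N⁻¹) ^ 2 := Fintype.sum_prod_type _
      _ ≤ ∑ _i : ι, N⁻¹ * (b - 1) := sum_le_sum fun i _ => hdev i
      _ = _ := by rw [sum_const, nsmul_eq_mul, card_univ]
  have hM : (2 : ℝ) ≤ Fintype.card ι := by exact_mod_cast hcard
  calc ((Fintype.card ι : ℝ) / 2 - 1) ^ 2 ≤ (∑ q ∈ A, (P q.1 q.2 - N⁻¹)) ^ 2 :=
        pow_le_pow_left₀ (by linarith) hlow 2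
    _ ≤ A.card * ∑ q ∈ A, (P q.1 q.2 - N⁻¹) ^ 2 := sq_sum_le_card_mul_sum_sq
    _ ≤ N * (Fintype.card ι * (N⁻¹ * (b - 1))) :=
        mul_le_mul hAcard htotal (sum_nonneg fun _ _ => sq_nonneg _) hN.le
    _ = Fintype.card ι * (b - 1) := by field_simp

/-! ### Ising models with a single edge -/

section SingleEdge

variable {p : ℕ}

/-- Flipping the spin at a vertex. -/
def flipSpin (s : Fin p) (x : Config p) : Config p := Function.update x s (-x s)

theorem flipSpin_involutive (s : Fin p) : Function.Involutive (flipSpin s) := by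
  intro x
  simp [flipSpin]

theorem pairSpin_mk (x : Config p) (s t : Fin p) :
    pairSpin x s(s, t) = ((x s : ℤ) : ℝ) * ((x t : ℤ) : ℝ) := rfl

theorem pairSpin_flipSpin {s t : Fin p} (h : s ≠ t) (x : Config p) :
    pairSpin (flipSpin s x) s(s, t) = -pairSpin x s(s, t) := by
  simp [pairSpin_mk, flipSpin, Function.update_of_ne h.symm]

theorem pairSpin_eq_one_or (x : Config p) (e : Sym2 (Fin p)) :
    pairSpin x e = 1 ∨ pairSpin x e = -1 := by
  induction e with
  | _ s t =>
    rw [pairSpin_mk]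
    rcases Int.units_eq_one_or (x s) with hs | hs <;>
      rcases Int.units_eq_one_or (x t) with ht | ht <;> simp [hs, ht]

theorem sum_pairSpin {e : Sym2 (Fin p)} (he : ¬ e.IsDiag) : ∑ x : Config p, pairSpin x e = 0 := by
  induction e with
  | _ s t =>
    have hst : s ≠ t := by simpa using he
    have h := Equiv.sum_comp (flipSpin_involutive s).toPerm fun x : Config p => pairSpin x s(s, t)
    simp only [Function.Involutive.coe_toPerm, pairSpin_flipSpin hst, sum_neg_distrib] at h
    linarith

theorem sum_exp_mul_pairSpin {e : Sym2 (Fin p)} (he : ¬ e.IsDiag) (a : ℝ) :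
    ∑ x : Config p, Real.exp (a * pairSpin x e) = Fintype.card (Config p) * Real.cosh a := by
  have h : ∀ x : Config p,
      Real.exp (a * pairSpin x e) = Real.cosh a + pairSpin x e * Real.sinh a := by
    intro x
    rcases pairSpin_eq_one_or x e with hx | hx <;> rw [hx]
    · rw [mul_one, one_mul, Real.cosh_add_sinh]
    · rw [mul_neg_one, neg_one_mul, ← sub_eq_add_neg, Real.cosh_sub_sinh]
  simp only [h, sum_add_distrib, ← sum_mul, sum_pairSpin he, sum_const, nsmul_eq_mul, card_univ]
  ring

/-- The graph with the single edge `e`. -/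
def singleEdge (e : Sym2 (Fin p)) : SimpleGraph (Fin p) := SimpleGraph.fromEdgeSet {e}

theorem edgeSet_singleEdge {e : Sym2 (Fin p)} (he : ¬ e.IsDiag) :
    (singleEdge e).edgeSet = {e} := by
  rw [singleEdge, SimpleGraph.edgeSet_fromEdgeSet, sdiff_eq_left, Set.disjoint_singleton_left]
  simpa using he

open Classical in
/-- The weights that are `lam` on the edges of `G` and zero elsewhere. -/
noncomputable def constWeights (lam : ℝ) (G : SimpleGraph (Fin p)) : Weights p :=
  fun e => if e ∈ G.edgeSet then lam else 0

open Classical in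
theorem edgeFinset_singleEdge {e : Sym2 (Fin p)} (he : ¬ e.IsDiag) :
    (singleEdge e).edgeFinset = {e} := by
  ext f
  rw [SimpleGraph.mem_edgeFinset, edgeSet_singleEdge he]
  simp

theorem energy_singleEdge {e : Sym2 (Fin p)} (he : ¬ e.IsDiag) (lam : ℝ) (x : Config p) :
    energy (singleEdge e) (constWeights lam (singleEdge e)) x = lam * pairSpin x e := by
  classical
  have h := edgeFinset_singleEdge he
  rw [energy]
  convert (sum_singleton (fun f => constWeights lam (singleEdge e) f * pairSpin x f) e) using 1
  · convert rfl
    exact h.symm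
  · simp [constWeights, edgeSet_singleEdge he]

theorem inFamily_singleEdge {k : ℕ} {lam om : ℝ} (hk : 1 ≤ k) (hlam : 0 < lam) (hle : lam ≤ om)
    {e : Sym2 (Fin p)} (he : ¬ e.IsDiag) :
    InFamily p k lam om (singleEdge e) (constWeights lam (singleEdge e)) := by
  classical
  refine ⟨?_, ?_, ?_, ?_⟩
  · have h := edgeFinset_singleEdge he
    have h1 : (singleEdge e).edgeFinset.card = 1 := by rw [h, card_singleton]
    convert hk
  · intro f hf
    by_contra h
    exact hf (if_neg h)
  · intro f hf
    rw [constWeights, if_pos hf]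
    exact le_abs_self _
  · intro s
    have hw : ∀ t ∈ (singleEdge e).neighborFinset s,
        |constWeights lam (singleEdge e) s(s, t)| = lam := by
      intro t ht
      rw [SimpleGraph.mem_neighborFinset] at ht
      rw [constWeights, if_pos (by simpa using ht), abs_of_pos hlam]
    have hc : ((singleEdge e).neighborFinset s).card ≤ 1 := by
      refine card_le_one.2 fun t ht t' ht' => ?_
      rw [SimpleGraph.mem_neighborFinset, ← SimpleGraph.mem_edgeSet, edgeSet_singleEdge he,
        Set.mem_singleton_iff] at ht ht'
      exact Sym2.congr_right.1 (ht.trans ht'.symm)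
    have hc' : (((singleEdge e).neighborFinset s).card : ℝ) ≤ 1 := by exact_mod_cast hc
    have : ∑ t ∈ (singleEdge e).neighborFinset s, |constWeights lam (singleEdge e) s(s, t)| ≤ om := by
      rw [sum_congr rfl hw, sum_const, nsmul_eq_mul]
      nlinarith
    convert this

end SingleEdge

/-! ### Second moments of the sample law and the resulting lower bound -/

section Samples

variable {n p : ℕ}

theorem sum_isingProb (G : SimpleGraph (Fin p)) (θ : Weights p) : ∑ x, isingProb G θ x = 1 := by
  have h : 0 < partitionFn G θ := sum_pos (fun _ _ => Real.exp_pos _) univ_nonempty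
  simp only [isingProb, ← sum_div]
  exact div_self h.ne'

theorem sum_prod_apply (f : Config p → ℝ) :
    ∑ X : Sample n p, ∏ i, f (X i) = (∑ x, f x) ^ n := by
  rw [Fintype.sum_pow]

theorem sum_sampleProb (G : SimpleGraph (Fin p)) (θ : Weights p) :
    ∑ X : Sample n p, sampleProb G θ X = 1 := by
  simp only [sampleProb, sum_prod_apply, sum_isingProb, one_pow]

/-- The left side equals `cosh (2 lam) / cosh lam ^ 2`; the denominator is at least `1`, and `cosh x
≤ exp (x² / 2)`. -/
theorem card_mul_sum_isingProb_sq_le {e : Sym2 (Fin p)} (he : ¬ e.IsDiag) (lam : ℝ) :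
    Fintype.card (Config p) *
        ∑ x, isingProb (singleEdge e) (constWeights lam (singleEdge e)) x ^ 2 ≤
      Real.exp (2 * lam ^ 2) := by
  have hN : (0 : ℝ) < Fintype.card (Config p) := by exact_mod_cast Fintype.card_pos
  have hc : 1 ≤ Real.cosh lam := Real.one_le_cosh lam
  have hsq : ∀ x : Config p, Real.exp (lam * pairSpin x e) ^ 2 =
      Real.exp (2 * lam * pairSpin x e) := by
    intro x
    rw [← Real.exp_nat_mul]
    push_cast
    ring_nf
  have hcosh : Real.cosh (2 * lam) ≤ Real.exp (2 * lam ^ 2) := by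
    refine (Real.cosh_le_exp_half_sq (2 * lam)).trans_eq ?_
    congr 1
    ring
  simp only [isingProb, partitionFn, energy_singleEdge he, div_pow, ← sum_div, hsq,
    sum_exp_mul_pairSpin he]
  rw [← mul_div_assoc, div_le_iff₀ (by positivity)]
  have h1 : 1 ≤ Real.cosh lam ^ 2 := one_le_pow₀ hc
  calc (Fintype.card (Config p) : ℝ) * (Fintype.card (Config p) * Real.cosh (2 * lam))
      = (Fintype.card (Config p) : ℝ) ^ 2 * Real.cosh (2 * lam) := by ring
    _ ≤ (Fintype.card (Config p) : ℝ) ^ 2 * (Real.exp (2 * lam ^ 2) * Real.cosh lam ^ 2) := by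
        gcongr
        exact hcosh.trans (le_mul_of_one_le_right (Real.exp_pos _).le h1)
    _ = _ := by ring

/-- The second moment relative to uniform is multiplicative over independent samples. -/
theorem card_mul_sum_sampleProb_sq_le {e : Sym2 (Fin p)} (he : ¬ e.IsDiag) (lam : ℝ) :
    Fintype.card (Sample n p) *
        ∑ X : Sample n p, sampleProb (singleEdge e) (constWeights lam (singleEdge e)) X ^ 2 ≤
      Real.exp (2 * n * lam ^ 2) := by
  simp only [sampleProb, ← prod_pow]
  rw [sum_prod_apply fun x => isingProb (singleEdge e) (constWeights lam (singleEdge e)) x ^ 2,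
    Fintype.card_fun, Fintype.card_fin, Nat.cast_pow, ← mul_pow]
  refine (pow_le_pow_left₀ (by positivity) (card_mul_sum_isingProb_sq_le he lam) n).trans_eq ?_
  rw [← Real.exp_nat_mul]
  ring_nf

/-- A decoder that recovers each single-edge graph with probability `1/2` needs order
`lam⁻² log p` samples. -/
theorem log_le_of_successProb_singleEdge (hp : 3 ≤ p) (lam : ℝ) (φ : Decoder n p)
    (h : ∀ e : Sym2 (Fin p), ¬ e.IsDiag →
      1 / 2 ≤ successProb φ (singleEdge e) (constWeights lam (singleEdge e))) :
    Real.log p ≤ 48 * (n * lam ^ 2) := by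
  classical
  have hinj : Function.Injective fun e : {e : Sym2 (Fin p) // ¬ e.IsDiag} => singleEdge e.1 := by
    rintro ⟨e, he⟩ ⟨f, hf⟩ hef
    have := congrArg SimpleGraph.edgeSet hef
    simp only [edgeSet_singleEdge he, edgeSet_singleEdge hf, Set.singleton_eq_singleton_iff] at this
    exact Subtype.ext this
  have hpM : p ≤ Fintype.card {e : Sym2 (Fin p) // ¬ e.IsDiag} := by
    rw [Sym2.card_subtype_not_diag, Fintype.card_fin, Nat.choose_two_right,
      Nat.le_div_iff_mul_le two_pos]
    exact Nat.mul_le_mul_left p (by omega)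
  have hmain := sq_half_card_sub_one_le
    (fun (e : {e : Sym2 (Fin p) // ¬ e.IsDiag}) (X : Sample n p) =>
      sampleProb (singleEdge e.1) (constWeights lam (singleEdge e.1)) X)
    φ (fun e => singleEdge e.1) hinj (Real.exp (2 * n * lam ^ 2))
    (fun e => sum_sampleProb _ _) (fun e => card_mul_sum_sampleProb_sq_le e.2 lam)
    (fun e => by
      have he := h e.1 e.2
      rw [successProb] at he
      convert he) (by omega)
  set M : ℝ := (Fintype.card {e : Sym2 (Fin p) // ¬ e.IsDiag} : ℝ)
  have hpM' : (p : ℝ) ≤ M := Nat.cast_le.2 hpM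
  have hp' : (3 : ℝ) ≤ p := by exact_mod_cast hp
  set b := Real.exp (2 * n * lam ^ 2) with hb
  have hbp : 1 + (1 / 24 : ℝ) * (p - 1) ≤ b := by
    have h1 : M * (1 + (1 / 24 : ℝ) * (M - 1)) ≤ M * b := by
      -- Clearing denominators in `(M/2 - 1)² ≥ M (M - 1) / 24` leaves `(5M - 8)(M - 3) ≥ 0`; the
      -- constant `1/24` is sharp at `M = 3`.
      nlinarith [mul_nonneg (by linarith : (0 : ℝ) ≤ 5 * M - 8) (by linarith : (0 : ℝ) ≤ M - 3)]
    have h2 := le_of_mul_le_mul_left h1 (by linarith)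
    linarith
  -- Bernoulli's inequality turns the linear bound into a power of `p`, so that taking logarithms
  -- costs only a factor, even for small `p`.
  have hbern : (p : ℝ) ^ (1 / 24 : ℝ) ≤ 1 + (1 / 24 : ℝ) * (p - 1) := by
    have := rpow_one_add_le_one_add_mul_self (s := (p : ℝ) - 1) (p := 1 / 24)
      (by linarith) (by norm_num) (by norm_num)
    rwa [add_sub_cancel] at this
  have hlog := Real.log_le_log (by positivity) (hbern.trans hbp)
  rw [Real.log_rpow (by linarith), hb, Real.log_exp] at hlog
  linarith

end Samples

open Classical in
/-- A weight table that uses the constant weight `lam` wherever this is admissible. -/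
theorem exists_isWeightTable (p k : ℕ) (lam om : ℝ) :
    ∃ W, IsWeightTable p k lam om W ∧
      ∀ G, InFamily p k lam om G (constWeights lam G) → W G = constWeights lam G := by
  refine ⟨fun G => if InFamily p k lam om G (constWeights lam G) then constWeights lam G
    else if h : ∃ θ, InFamily p k lam om G θ then h.choose else 0, ?_, ?_⟩
  · intro G hG
    by_cases h : InFamily p k lam om G (constWeights lam G)
    · simpa only [if_pos h] using h
    · simpa only [if_neg h, dif_pos hG] using hG.choose_spec
  · intro G h
    simp only [if_pos h]

theorem max_mul_log_lt {C lam : ℝ} {p k n : ℕ} (hp : 3 ≤ p) (hk : 1 ≤ k)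
    (hlam : 0 < lam) (hC : lam ≤ C / Real.sqrt k) (h : Real.log p ≤ 48 * (n * lam ^ 2)) :
    (96 * (1 + C ^ 2))⁻¹ * max (k : ℝ) ((lam ^ 2)⁻¹) * Real.log p < n := by
  have hp' : (3 : ℝ) ≤ p := by exact_mod_cast hp
  have hk' : (0 : ℝ) < k := by exact_mod_cast hk
  have hlog : 0 < Real.log p := Real.log_pos (by linarith)
  have hl2 : 0 < lam ^ 2 := by positivity
  have hn : 0 < (n : ℝ) * lam ^ 2 := by linarith
  have hkl : lam ^ 2 * k ≤ C ^ 2 := by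
    have h1 : lam * Real.sqrt k ≤ C := (le_div_iff₀ (Real.sqrt_pos.2 hk')).1 hC
    have h2 := pow_le_pow_left₀ (by positivity) h1 2
    rwa [mul_pow, Real.sq_sqrt hk'.le] at h2
  have hmax : max (k : ℝ) ((lam ^ 2)⁻¹) ≤ (1 + C ^ 2) * (lam ^ 2)⁻¹ := by
    rw [← div_eq_mul_inv, le_div_iff₀ hl2]
    rcases max_cases (k : ℝ) ((lam ^ 2)⁻¹) with ⟨hm, -⟩ | ⟨hm, -⟩ <;> rw [hm]
    · linarith
    · rw [inv_mul_cancel₀ hl2.ne']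
      nlinarith [sq_nonneg C]
  have hC2 : 0 < 1 + C ^ 2 := by positivity
  calc (96 * (1 + C ^ 2))⁻¹ * max (k : ℝ) ((lam ^ 2)⁻¹) * Real.log p
      ≤ (96 * (1 + C ^ 2))⁻¹ * ((1 + C ^ 2) * (lam ^ 2)⁻¹) * (48 * (n * lam ^ 2)) := by gcongr
    -- Taking `96 = 2 * 48` leaves `n / 2`, which gives strictness: `n > 0` because `log p > 0`.
    _ = n / 2 := by field_simp; ring
    _ < n := half_lt_self (pos_of_mul_pos_left hn hl2.le)

end IsingSelection

open IsingSelection in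
theorem corollary2 (C : ℝ) (hC : 0 < C) :
    ∃ c : ℝ, 0 < c ∧
      ∀ (p k n : ℕ) (lam om : ℝ), 3 ≤ p → 1 ≤ k → 0 < lam → lam ≤ om →
        lam ≤ C / Real.sqrt k →
        -- known edge weights: the decoder is given the table of weights
        (∀ φ : (SimpleGraph (Fin p) → Weights p) → Decoder n p,
          (∀ W, IsWeightTable p k lam om W →
            ∀ G, InFamily p k lam om G (W G) → 1 / 2 ≤ successProb (φ W) G (W G)) →
          c * max (k : ℝ) ((lam ^ 2)⁻¹) * Real.log p < n) ∧
        -- unknown edge weights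
        (∀ φ : Decoder n p,
          (∀ G θ, InFamily p k lam om G θ → 1 / 2 ≤ successProb φ G θ) →
          c * max (k : ℝ) ((lam ^ 2)⁻¹) * Real.log p < n) := by
  refine ⟨(96 * (1 + C ^ 2))⁻¹, by positivity, ?_⟩
  intro p k n lam om hp hk hlam hle hlamC
  refine ⟨fun φ hφ => ?_, fun φ hφ => ?_⟩
  · obtain ⟨W, hW, hWG⟩ := exists_isWeightTable p k lam om
    refine max_mul_log_lt hp hk hlam hlamC
      (log_le_of_successProb_singleEdge hp lam (φ W) fun e he => ?_)
    have hfam := inFamily_singleEdge hk hlam hle he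
    have hWe := hWG _ hfam
    rw [← hWe] at hfam ⊢
    exact hφ W hW _ hfam
  · exact max_mul_log_lt hp hk hlam hlamC
      (log_le_of_successProb_singleEdge hp lam φ fun e he =>
        hφ _ _ (inFamily_singleEdge hk hlam hle he))
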